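/- Let $m,n\ge 1$ be integers. Let $\mathcal S(n)$ be the real vector space of real symmetric $n\times n$ matrices and $S_+(n)\subset\mathcal S(n)$ the cone of positive semidefinite matrices. Let $\mathcal Q(m)$ be the real vector space of quaternionic hermitian $m\times m$ matrices and $Q_+(m)\subset\mathcal Q(m)$ the cone of positive semidefinite matrices, where a quaternionic hermitian matrix $A$ is called positive semidefinite (PSD) if $v^*Av\ge 0$ for every quaternionic column vector $v$. By means of the Kronecker product, regard $\mathcal Q(m)\otimes_{\mathbb R}\mathcal S(n)$ as a subspace of $\mathcal Q(mn)$. An element of $\mathcal Q(m)\otimes\mathcal S(n)$ is called $Q_+(m)\otimes S_+(n)$-separable if it can be written as a finite sum $\sum_{l=1}^N p_l\,A_l\otimes B_l$ with $p_l>0$, $A_l\in Q_+(m)$ and $B_l\in S_+(n)$ for all $l$. Theorem. The cone of $Q_+(m)\otimes S_+(n)$-separable matrices in $\mathcal Q(m)\otimes\mathcal S(n)$ coincides with the cone of PSD matrices in this space if and only if $n\le 2$ or $m=1$. -/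

import Mathlib

open scoped Quaternion TensorProduct Kronecker Matrix

/-- The real vector space `S(n)` of real symmetric `n × n` matrices. -/
def SymMat (n : ℕ) : Submodule ℝ (Matrix (Fin n) (Fin n) ℝ) where
  carrier := {A | A.IsSymm}
  add_mem' hA hB := hA.add hB
  zero_mem' := Matrix.isSymm_zero
  smul_mem' r _ hA := hA.smul r

/-- The real vector space `Q(n)` of quaternionic hermitian `n × n` matrices. -/
def QuatHermMat (n : ℕ) : Submodule ℝ (Matrix (Fin n) (Fin n) ℍ[ℝ]) where
  carrier := {A | A.IsHermitian}
  add_mem' hA hB := hA.add hB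
  zero_mem' := Matrix.isHermitian_zero
  smul_mem' r A hA := by
    refine Matrix.IsHermitian.ext fun i j => ?_
    rw [Matrix.smul_apply, Matrix.smul_apply, Quaternion.star_smul, Matrix.IsHermitian.apply hA]

/-- A quaternionic matrix `M` is positive semidefinite if it is hermitian and `v* M v ≥ 0` for every
(column) vector `v`. For hermitian `M` the quaternion `v* M v` is real
(see `quat_form_eq_re`), so that this is a condition on its real part. -/
def IsQuatPSD {ι : Type*} [Fintype ι] (M : Matrix ι ι ℍ[ℝ]) : Prop :=
  M.IsHermitian ∧ ∀ v : ι → ℍ[ℝ], 0 ≤ (star v ⬝ᵥ (M *ᵥ v)).re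

/-- For hermitian `M`, the quaternion `v* M v` is real. -/
theorem quat_form_eq_re {ι : Type*} [Fintype ι] {M : Matrix ι ι ℍ[ℝ]} (hM : M.IsHermitian)
    (v : ι → ℍ[ℝ]) :
    star v ⬝ᵥ (M *ᵥ v) = (((star v ⬝ᵥ (M *ᵥ v)).re : ℝ) : ℍ[ℝ]) := by
  rw [← Quaternion.star_eq_self]
  nth_rewrite 1 [← Matrix.star_dotProduct_star]
  rw [star_star, Matrix.star_mulVec, hM.eq, ← Matrix.dotProduct_mulVec]

/-- The cone `S₊(n)` of positive semidefinite matrices in `S(n)`. -/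
def SymPSD (n : ℕ) : Set (SymMat n) := {A | (A : Matrix (Fin n) (Fin n) ℝ).PosSemidef}

/-- The cone `Q₊(n)` of positive semidefinite matrices in `Q(n)`. -/
def QuatPSD (n : ℕ) : Set (QuatHermMat n) := {A | IsQuatPSD (A : Matrix (Fin n) (Fin n) ℍ[ℝ])}

/-- The set of `K ⊗ K'`-separable elements of `E ⊗ E'`: the sums `∑ p_l x_l ⊗ x'_l` with finitely
many terms, `p_l > 0`, `x_l ∈ K` and `x'_l ∈ K'`. -/
def SeparableCone {E E' : Type*} [AddCommGroup E] [Module ℝ E] [AddCommGroup E'] [Module ℝ E']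
    (K : Set E) (K' : Set E') : Set (E ⊗[ℝ] E') :=
  {w | ∃ (N : ℕ) (p : Fin N → ℝ) (x : Fin N → E) (x' : Fin N → E'),
    (∀ l, 0 < p l) ∧ (∀ l, x l ∈ K) ∧ (∀ l, x' l ∈ K') ∧ w = ∑ l, p l • (x l ⊗ₜ[ℝ] x' l)}

/-- The Kronecker product of a quaternionic matrix and a real matrix. -/
noncomputable def kronReal {m n : ℕ} (A : Matrix (Fin m) (Fin m) ℍ[ℝ]) (B : Matrix (Fin n) (Fin n) ℝ) :
    Matrix (Fin m × Fin n) (Fin m × Fin n) ℍ[ℝ] :=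
  A ⊗ₖ B.map (fun b : ℝ => (b : ℍ[ℝ]))

/-- The linear map from `Q(m) ⊗ S(n)` to the quaternionic `mn × mn` matrices that sends `A ⊗ B` to
the Kronecker product of `A` and `B`. It is injective (`kron_injective`) and has hermitian values
(`kron_isHermitian`). -/
noncomputable def kron (m n : ℕ) :
    QuatHermMat m ⊗[ℝ] SymMat n →ₗ[ℝ] Matrix (Fin m × Fin n) (Fin m × Fin n) ℍ[ℝ] :=
  TensorProduct.lift (LinearMap.mk₂ ℝ (fun A B => kronReal A.1 B.1)
    (fun A A' B => by ext1 a b; simp [kronReal, add_mul])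
    (fun c A B => by ext1 a b; simp [kronReal])
    (fun A B B' => by ext1 a b; simp [kronReal, mul_add])
    (fun c A B => by
      ext1 a b
      simp only [kronReal, Matrix.kroneckerMap_apply, Matrix.map_apply, Matrix.smul_apply,
        Submodule.coe_smul, smul_eq_mul, Quaternion.coe_mul, ← Quaternion.coe_mul_eq_smul]
      rw [← mul_assoc, ← mul_assoc, Quaternion.coe_commutes]))

@[simp] theorem kron_tmul {m n : ℕ} (A : QuatHermMat m) (B : SymMat n) :
    kron m n (A ⊗ₜ[ℝ] B) = kronReal A.1 B.1 := by
  simp [kron]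

theorem kron_isHermitian {m n : ℕ} (w : QuatHermMat m ⊗[ℝ] SymMat n) :
    (kron m n w).IsHermitian := by
  induction w with
  | zero => simp
  | add x y hx hy => rw [map_add]; exact hx.add hy
  | tmul A B =>
    rw [kron_tmul]
    ext1 a b
    have hA := A.2.apply a.1 b.1
    have hB := B.2.apply a.2 b.2
    simp only [Matrix.conjTranspose_apply, kronReal, Matrix.kroneckerMap_apply, Matrix.map_apply,
      star_mul, Quaternion.star_coe, hA, hB]
    exact Quaternion.coe_commutes _ _

theorem kron_injective (m n : ℕ) : Function.Injective (kron m n) := by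
  let f := TensorProduct.map (QuatHermMat m).subtype (SymMat n).subtype
  have hf : Function.Injective f := by
    have h1 := Module.Flat.rTensor_preserves_injective_linearMap (M := SymMat n)
      (QuatHermMat m).subtype (Submodule.subtype_injective _)
    have h2 := Module.Flat.lTensor_preserves_injective_linearMap
      (M := Matrix (Fin m) (Fin m) ℍ[ℝ]) (SymMat n).subtype (Submodule.subtype_injective _)
    have h3 : f = (SymMat n).subtype.lTensor _ ∘ₗ (QuatHermMat m).subtype.rTensor _ := by
      rw [LinearMap.lTensor_comp_rTensor]
    rw [h3]
    exact h2.comp h1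
  let g := kroneckerTMulLinearEquiv (Fin m) (Fin m) (Fin n) (Fin n) ℝ ℝ ℍ[ℝ] ℝ
  let h := (TensorProduct.rid ℝ ℍ[ℝ]).mapMatrix (m := Fin m × Fin n) (n := Fin m × Fin n)
  have key : ∀ w, kron m n w = h (g (f w)) := by
    intro w
    induction w with
    | zero => simp
    | add x y hx hy => simp only [map_add, hx, hy]
    | tmul A B =>
      ext1 a b
      simp [f, g, h, kronReal, Matrix.kroneckerMap_apply,
        ← Quaternion.coe_mul_eq_smul, Quaternion.coe_commutes]
  intro x y hxy
  rw [key, key] at hxy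
  exact hf (g.injective (h.injective hxy))

/-- The space `Q(m) ⊗ S(n)`, regarded as a subspace of the quaternionic hermitian `mn × mn`
matrices. -/
noncomputable def quatSymSpace (m n : ℕ) :
    Submodule ℝ (Matrix (Fin m × Fin n) (Fin m × Fin n) ℍ[ℝ]) :=
  LinearMap.range (kron m n)

/-- The cone of `Q₊(m) ⊗ S₊(n)`-separable matrices in `Q(m) ⊗ S(n)`. -/
def separableMatrices (m n : ℕ) : Set (Matrix (Fin m × Fin n) (Fin m × Fin n) ℍ[ℝ]) :=
  kron m n '' SeparableCone (QuatPSD m) (SymPSD n)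

/-- The cone of positive semidefinite matrices in `Q(m) ⊗ S(n)`. -/
def psdMatrices (m n : ℕ) : Set (Matrix (Fin m × Fin n) (Fin m × Fin n) ℍ[ℝ]) :=
  {M | M ∈ quatSymSpace m n ∧ IsQuatPSD M}

/-! Separable matrices are PSD because `A ⊗ x xᵀ` is a congruence of `A`. Membership in `Q(m) ⊗
S(n)` means being hermitian and unchanged when the two `Fin n` indices are swapped.

For `n = 2`, such a matrix has blocks `A, C, C, B`, and its real form has the same shape with
symmetric real blocks. Write `A = R²`. Positivity forces `C = R S R` with `S` symmetric, so an
eigenbasis of `S` splits off terms `w wᵀ ⊗ (1, c)(1, c)ᵀ`. What remains is the Schur complement of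
`A`, in the corner `(0, 1)(0, 1)ᵀ` (`exists_eq_sum_smul_vecMulVec_of_nonneg`). Averaging over the
basis of the quaternions (`sum_re_smul_quatBasis`) turns this into a quaternionic decomposition. For
`m = 1` the two symmetries make all entries real.

For `m ≥ 2` and `n ≥ 3` the obstruction is transposition. It preserves positivity on `Q(2)`
(`IsQuatPSD.transpose_two`), hence on separable matrices with `m = 2`, but not on all PSD matrices
of `Q(2) ⊗ S(3)`. -/

/-! ### Real positive semidefinite block matrices -/

/-- A positive semidefinite matrix has a symmetric square root with a commuting symmetric
pseudo-inverse. -/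
theorem Matrix.PosSemidef.exists_sqrt_pseudoinverse {ι : Type*} [Fintype ι] [DecidableEq ι]
    {A : Matrix ι ι ℝ} (hA : A.PosSemidef) :
    ∃ R R' : Matrix ι ι ℝ, Rᵀ = R ∧ R'ᵀ = R' ∧ R * R = A ∧ R * R' = R' * R ∧
      R * R' * R = R ∧ R' * R * R' = R' := by
  set U : Matrix ι ι ℝ := (hA.1.eigenvectorUnitary : Matrix ι ι ℝ)
  have hUU : Uᵀ * U = 1 := by
    have := Unitary.coe_star_mul_self hA.1.eigenvectorUnitary
    simpa [Matrix.star_eq_conjTranspose, Matrix.conjTranspose_eq_transpose_of_trivial] using this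
  let F (d : ι → ℝ) : Matrix ι ι ℝ := U * Matrix.diagonal d * Uᵀ
  have hF : ∀ c d, F c * F d = F (c * d) := fun c d => by
    calc F c * F d = U * Matrix.diagonal c * (Uᵀ * U) * Matrix.diagonal d * Uᵀ := by
          simp only [F, Matrix.mul_assoc]
      _ = F (c * d) := by
          rw [hUU, Matrix.mul_one, Matrix.mul_assoc U, Matrix.diagonal_mul_diagonal]; rfl
  have hFt : ∀ d, (F d)ᵀ = F d := fun d => by
    simp only [F, Matrix.transpose_mul, Matrix.transpose_transpose, Matrix.diagonal_transpose,
      Matrix.mul_assoc]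
  have hFA : F hA.1.eigenvalues = A := by
    have := hA.1.spectral_theorem
    rw [Unitary.conjStarAlgAut_apply] at this
    simpa [F, Matrix.star_eq_conjTranspose, Matrix.conjTranspose_eq_transpose_of_trivial,
      Function.comp_def] using this.symm
  let r : ι → ℝ := fun i => √(hA.1.eigenvalues i)
  refine ⟨F r, F r⁻¹, hFt _, hFt _, ?_, ?_, ?_, ?_⟩
  · rw [hF, ← hFA]
    congr 1
    ext i
    exact Real.mul_self_sqrt (hA.eigenvalues_nonneg i)
  · rw [hF, hF, mul_comm]
  · rw [hF, hF]
    congr 1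
    ext i
    by_cases h : r i = 0 <;> simp [h]
  · rw [hF, hF]
    congr 1
    ext i
    by_cases h : r i = 0 <;> simp [h]

/-- A real positive semidefinite matrix is a sum of matrices of rank one. -/
theorem Matrix.PosSemidef.exists_eq_sum_vecMulVec {ι : Type*} [Fintype ι] [DecidableEq ι]
    {A : Matrix ι ι ℝ} (hA : A.PosSemidef) :
    ∃ w : ι → ι → ℝ, A = ∑ k, Matrix.vecMulVec (w k) (w k) := by
  obtain ⟨R, _, hR, -, hRR, -⟩ := hA.exists_sqrt_pseudoinverse
  refine ⟨fun k i => R k i, ?_⟩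
  nth_rewrite 1 [← hRR, ← hR]
  ext i j
  simp [Matrix.mul_apply, Matrix.sum_apply, Matrix.vecMulVec_apply]

theorem Matrix.IsSymm.exists_eigenbasis {ι : Type*} [Fintype ι] [DecidableEq ι]
    {S : Matrix ι ι ℝ} (hS : S.IsSymm) :
    ∃ (e : ι → ι → ℝ) (c : ι → ℝ), (1 : Matrix ι ι ℝ) = ∑ k, Matrix.vecMulVec (e k) (e k) ∧
      S = ∑ k, c k • Matrix.vecMulVec (e k) (e k) ∧
      S * S = ∑ k, (c k * c k) • Matrix.vecMulVec (e k) (e k) := by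
  have hH : S.IsHermitian := by
    rwa [Matrix.IsHermitian, Matrix.conjTranspose_eq_transpose_of_trivial]
  set U : Matrix ι ι ℝ := (hH.eigenvectorUnitary : Matrix ι ι ℝ)
  have hUU : U * Uᵀ = 1 := by
    have := Unitary.coe_mul_star_self hH.eigenvectorUnitary
    simpa [Matrix.star_eq_conjTranspose, Matrix.conjTranspose_eq_transpose_of_trivial] using this
  have h1 : (1 : Matrix ι ι ℝ) = ∑ k, Matrix.vecMulVec (fun i => U i k) (fun i => U i k) := by
    rw [← hUU]
    ext i j
    simp [Matrix.mul_apply, Matrix.sum_apply, Matrix.vecMulVec_apply]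
  have hSe : ∀ k, S * Matrix.vecMulVec (fun i => U i k) (fun i => U i k) =
      hH.eigenvalues k • Matrix.vecMulVec (fun i => U i k) (fun i => U i k) := fun k => by
    have h : S *ᵥ (fun i => U i k) = hH.eigenvalues k • fun i => U i k := hH.mulVec_eigenvectorBasis k
    rw [Matrix.mul_vecMulVec, h, Matrix.smul_vecMulVec]
  have h2 : S = ∑ k, hH.eigenvalues k • Matrix.vecMulVec (fun i => U i k) (fun i => U i k) := by
    calc S = S * 1 := (mul_one S).symm
      _ = _ := by rw [h1, Finset.mul_sum]; exact Finset.sum_congr rfl fun k _ => hSe k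
  refine ⟨fun k i => U i k, hH.eigenvalues, h1, h2, ?_⟩
  nth_rewrite 2 [h2]
  rw [Finset.mul_sum]
  exact Finset.sum_congr rfl fun k _ => by rw [Matrix.mul_smul, hSe, smul_smul]

/-- A positive semidefinite real `2 × 2` block matrix with symmetric blocks is a sum of Kronecker
products of positive semidefinite matrices of rank one. -/
theorem exists_eq_sum_smul_vecMulVec_of_nonneg {ι : Type*} [Fintype ι] [DecidableEq ι]
    (M : Fin 2 → Fin 2 → Matrix ι ι ℝ) (hM : ∀ s t, (M s t).IsSymm) (hst : M 0 1 = M 1 0)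
    (hpos : ∀ x : Fin 2 → ι → ℝ, 0 ≤ ∑ s, ∑ t, x s ⬝ᵥ (M s t *ᵥ x t)) :
    ∃ (w : ι ⊕ ι → ι → ℝ) (x : ι ⊕ ι → Fin 2 → ℝ),
      ∀ s t, M s t = ∑ l, (x l s * x l t) • Matrix.vecMulVec (w l) (w l) := by
  obtain ⟨A, hA⟩ : ∃ A, A = M 0 0 := ⟨_, rfl⟩
  obtain ⟨B, hB⟩ : ∃ B, B = M 1 1 := ⟨_, rfl⟩
  obtain ⟨C, hC⟩ : ∃ C, C = M 0 1 := ⟨_, rfl⟩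
  have hAs : Aᵀ = A := hA ▸ hM 0 0
  have hBs : Bᵀ = B := hB ▸ hM 1 1
  have hCs : Cᵀ = C := hC ▸ hM 0 1
  have hq : ∀ x y, 0 ≤ x ⬝ᵥ (A *ᵥ x) + 2 * (x ⬝ᵥ (C *ᵥ y)) + y ⬝ᵥ (B *ᵥ y) := fun x y => by
    have h := hpos ![x, y]
    have hxy : y ⬝ᵥ (C *ᵥ x) = x ⬝ᵥ (C *ᵥ y) := by
      rw [Matrix.dotProduct_mulVec, ← Matrix.mulVec_transpose, hCs, dotProduct_comm]
    simp only [Fin.sum_univ_two, Matrix.cons_val_zero, Matrix.cons_val_one, ← hA, ← hB, ← hC,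
      ← hst, hxy] at h
    linarith
  have hAp : A.PosSemidef := by
    refine Matrix.PosSemidef.of_dotProduct_mulVec_nonneg ?_ fun x => ?_
    · rwa [Matrix.IsHermitian, Matrix.conjTranspose_eq_transpose_of_trivial]
    · simpa using hq x 0
  obtain ⟨R, R', hR, hR', hRR, hcomm, hRR'R, hR'RR'⟩ := hAp.exists_sqrt_pseudoinverse
  -- `E = 1 - R R'` maps into the kernel of `A`, so on `(t E u, v)` the form is affine in `t`. Being
  -- nonnegative, it has slope zero.
  have hEC : R * R' * C = C := by
    set E := 1 - R * R' with hE
    have hAE : A * E = 0 := by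
      rw [hE, ← hRR, mul_sub, mul_one, hcomm, Matrix.mul_assoc R, ← Matrix.mul_assoc R R', hRR'R,
        sub_self]
    have hEt : Eᵀ = E := by
      rw [hE, Matrix.transpose_sub, Matrix.transpose_one, Matrix.transpose_mul, hR, hR', hcomm]
    have hEC0 : ∀ u v, u ⬝ᵥ ((E * C) *ᵥ v) = 0 := fun u v => by
      have h1 : ∀ t : ℝ, 0 ≤ 2 * t * (u ⬝ᵥ ((E * C) *ᵥ v)) + v ⬝ᵥ (B *ᵥ v) := fun t => by
        have h := hq (t • (E *ᵥ u)) v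
        rw [Matrix.mulVec_smul, Matrix.mulVec_mulVec, hAE, Matrix.zero_mulVec, smul_zero,
          dotProduct_zero, smul_dotProduct, ← Matrix.vecMul_transpose, hEt,
          ← Matrix.dotProduct_mulVec, Matrix.mulVec_mulVec, smul_eq_mul] at h
        linarith
      by_contra hne
      -- This `t` makes the affine function equal to `-1`.
      have h2 := h1 (-(v ⬝ᵥ (B *ᵥ v) + 1) / (2 * (u ⬝ᵥ ((E * C) *ᵥ v))))
      have h3 : 2 * (-(v ⬝ᵥ (B *ᵥ v) + 1) / (2 * (u ⬝ᵥ ((E * C) *ᵥ v)))) *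
          (u ⬝ᵥ ((E * C) *ᵥ v)) = -(v ⬝ᵥ (B *ᵥ v) + 1) := by
        field_simp
      linarith
    have hEC' : E * C = 0 := by
      ext i j
      have := hEC0 (Pi.single i 1) (Pi.single j 1)
      simpa using this
    rw [hE, sub_mul, one_mul, sub_eq_zero] at hEC'
    exact hEC'.symm
  have hCE : C * R' * R = C := by
    have := congrArg Matrix.transpose hEC
    rwa [Matrix.transpose_mul, Matrix.transpose_mul, hR, hR', hCs, ← Matrix.mul_assoc] at this
  have hSs : (R' * C * R').IsSymm := by
    rw [Matrix.IsSymm, Matrix.transpose_mul, Matrix.transpose_mul, hR', hCs, Matrix.mul_assoc]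
  obtain ⟨e, c, h1, hS, hSS⟩ := hSs.exists_eigenbasis
  have hQ1 : R' * R' * A * (R' * R') = R' * R' := by
    calc R' * R' * A * (R' * R') = R' * (R' * R) * (R * R') * R' := by
          rw [← hRR]; simp only [Matrix.mul_assoc]
      _ = R' * (R * R') * (R' * R * R') := by rw [hcomm]; simp only [Matrix.mul_assoc]
      _ = R' * R' := by rw [← Matrix.mul_assoc R', hR'RR']
  have hCRC : C * (R' * R') * C = R * (R' * C * R' * (R' * C * R')) * R := by
    calc C * (R' * R') * C = (R * R' * C) * (R' * R') * (C * R' * R) := by rw [hEC, hCE]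
      _ = _ := by simp only [Matrix.mul_assoc]
  have hDp : (B - C * (R' * R') * C).PosSemidef := by
    refine Matrix.PosSemidef.of_dotProduct_mulVec_nonneg ?_ fun y => ?_
    · rw [Matrix.IsHermitian, Matrix.conjTranspose_eq_transpose_of_trivial, Matrix.transpose_sub,
        hBs, Matrix.transpose_mul, Matrix.transpose_mul, Matrix.transpose_mul, hCs, hR',
        Matrix.mul_assoc C]
    -- `R' R'` is the pseudo-inverse of `A`, so this first argument minimises the form for fixed
    -- `y`; the minimum is the Schur complement at `y`.
    · have h := hq (-((R' * R' * C) *ᵥ y)) y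
      have ht : ∀ z, ((R' * R' * C) *ᵥ y) ⬝ᵥ z = y ⬝ᵥ ((C * (R' * R')) *ᵥ z) := fun z => by
        rw [dotProduct_comm, Matrix.dotProduct_mulVec, ← Matrix.mulVec_transpose,
          dotProduct_comm, Matrix.transpose_mul, Matrix.transpose_mul, hR', hCs]
      have hA3 : C * (R' * R') * A * (R' * R' * C) = C * (R' * R') * C := by
        calc _ = C * (R' * R' * A * (R' * R')) * C := by simp only [Matrix.mul_assoc]
          _ = _ := by rw [hQ1]
      rw [Matrix.mulVec_neg, neg_dotProduct_neg, neg_dotProduct, ht, ht, Matrix.mulVec_mulVec,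
        Matrix.mulVec_mulVec, Matrix.mulVec_mulVec, hA3] at h
      rw [star_trivial, Matrix.sub_mulVec, dotProduct_sub]
      linarith
  obtain ⟨g, hg⟩ := hDp.exists_eq_sum_vecMulVec
  have hRv : ∀ u : ι → ℝ, R * Matrix.vecMulVec u u * R = Matrix.vecMulVec (R *ᵥ u) (R *ᵥ u) :=
    fun u => by
      rw [Matrix.mul_vecMulVec, Matrix.vecMulVec_mul, ← Matrix.mulVec_transpose, hR]
  have hA' : A = ∑ k, Matrix.vecMulVec (R *ᵥ e k) (R *ᵥ e k) := by
    calc A = R * 1 * R := by rw [mul_one, hRR]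
      _ = _ := by rw [h1, Finset.mul_sum, Finset.sum_mul]; simp only [hRv]
  have hC' : C = ∑ k, c k • Matrix.vecMulVec (R *ᵥ e k) (R *ᵥ e k) := by
    calc C = R * (R' * C * R') * R := by
          rw [Matrix.mul_assoc R', ← Matrix.mul_assoc R, ← Matrix.mul_assoc, hEC, hCE]
      _ = _ := by
          rw [hS, Finset.mul_sum, Finset.sum_mul]
          simp only [Matrix.mul_smul, Matrix.smul_mul, hRv]
  have hB' : B = ∑ k, (c k * c k) • Matrix.vecMulVec (R *ᵥ e k) (R *ᵥ e k) +
      ∑ k, Matrix.vecMulVec (g k) (g k) := by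
    rw [← hg, hCRC, hSS, Finset.mul_sum, Finset.sum_mul]
    simp only [Matrix.mul_smul, Matrix.smul_mul, hRv]
    abel
  refine ⟨Sum.elim (fun k => R *ᵥ e k) g, Sum.elim (fun k => ![1, c k]) fun _ => ![0, 1], ?_⟩
  have key : M 0 0 = A ∧ M 0 1 = C ∧ M 1 0 = C ∧ M 1 1 = B := ⟨hA.symm, hC.symm, hst ▸ hC.symm, hB.symm⟩
  obtain ⟨k1, k2, k3, k4⟩ := key
  rw [Fin.forall_fin_two, Fin.forall_fin_two, Fin.forall_fin_two, k1, k2, k3, k4]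
  simp only [Fintype.sum_sum_type, Sum.elim_inl, Sum.elim_inr, Matrix.cons_val_zero,
    Matrix.cons_val_one, mul_one, one_mul, mul_zero, zero_smul, one_smul,
    Finset.sum_const_zero, add_zero]
  exact ⟨⟨hA', hC'⟩, hC', hB'⟩

/-! ### Quaternionic positive semidefinite matrices -/

theorem IsQuatPSD.conjTranspose_mul_mul {ι κ : Type*} [Fintype ι] [Fintype κ]
    {M : Matrix ι ι ℍ[ℝ]} (hM : IsQuatPSD M) (J : Matrix ι κ ℍ[ℝ]) :
    IsQuatPSD (Jᴴ * M * J) := by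
  refine ⟨Matrix.isHermitian_conjTranspose_mul_mul J hM.1, fun v => ?_⟩
  have h := hM.2 (J *ᵥ v)
  have e : star (J *ᵥ v) ⬝ᵥ (M *ᵥ (J *ᵥ v)) = star v ⬝ᵥ ((Jᴴ * M * J) *ᵥ v) := by
    rw [Matrix.star_mulVec, ← Matrix.dotProduct_mulVec, Matrix.mulVec_mulVec,
      Matrix.mulVec_mulVec]
  rwa [e] at h

theorem Quaternion.re_sum {ι : Type*} (s : Finset ι) (f : ι → ℍ[ℝ]) :
    (∑ i ∈ s, f i).re = ∑ i ∈ s, (f i).re :=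
  map_sum (QuaternionAlgebra.reₗ (-1 : ℝ) 0 (-1)) f s

theorem isQuatPSD_one {ι : Type*} [Fintype ι] [DecidableEq ι] :
    IsQuatPSD (1 : Matrix ι ι ℍ[ℝ]) := by
  refine ⟨Matrix.isHermitian_one, fun v => ?_⟩
  rw [Matrix.one_mulVec, dotProduct, Quaternion.re_sum]
  refine Finset.sum_nonneg fun i _ => ?_
  rw [Pi.star_apply, Quaternion.star_mul_self, Quaternion.re_coe]
  exact Quaternion.normSq_nonneg

theorem isQuatPSD_conjTranspose_mul_self {ι κ : Type*} [Fintype ι] [Fintype κ] [DecidableEq κ]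
    (J : Matrix κ ι ℍ[ℝ]) : IsQuatPSD (Jᴴ * J) := by
  simpa using isQuatPSD_one.conjTranspose_mul_mul J

theorem isQuatPSD_zero {ι : Type*} [Fintype ι] : IsQuatPSD (0 : Matrix ι ι ℍ[ℝ]) :=
  ⟨Matrix.isHermitian_zero, fun v => by simp⟩

theorem IsQuatPSD.add {ι : Type*} [Fintype ι] {M N : Matrix ι ι ℍ[ℝ]} (hM : IsQuatPSD M)
    (hN : IsQuatPSD N) : IsQuatPSD (M + N) := by
  refine ⟨hM.1.add hN.1, fun v => ?_⟩
  rw [Matrix.add_mulVec, dotProduct_add, Quaternion.re_add]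
  exact add_nonneg (hM.2 v) (hN.2 v)

theorem isQuatPSD_sum {ι κ : Type*} [Fintype ι] (s : Finset κ) {M : κ → Matrix ι ι ℍ[ℝ]}
    (hM : ∀ k ∈ s, IsQuatPSD (M k)) : IsQuatPSD (∑ k ∈ s, M k) :=
  Finset.sum_induction M IsQuatPSD (fun _ _ => IsQuatPSD.add) isQuatPSD_zero hM

theorem IsQuatPSD.smul {ι : Type*} [Fintype ι] {M : Matrix ι ι ℍ[ℝ]} (hM : IsQuatPSD M)
    {r : ℝ} (hr : 0 ≤ r) : IsQuatPSD (r • M) := by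
  refine ⟨?_, fun v => ?_⟩
  · refine Matrix.IsHermitian.ext fun i j => ?_
    rw [Matrix.smul_apply, Matrix.smul_apply, Quaternion.star_smul, Matrix.IsHermitian.apply hM.1]
  · rw [Matrix.smul_mulVec, dotProduct_smul, Quaternion.re_smul]
    exact mul_nonneg hr (hM.2 v)

/-- A congruence by a 0-1 matrix; `e` may repeat indices, which later allows enlarging a matrix as
well as cutting it down. -/
theorem IsQuatPSD.submatrix {ι κ : Type*} [Fintype ι] [Fintype κ] [DecidableEq ι]
    {M : Matrix ι ι ℍ[ℝ]} (hM : IsQuatPSD M) (e : κ → ι) : IsQuatPSD (M.submatrix e e) := by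
  have h := hM.conjTranspose_mul_mul ((1 : Matrix ι ι ℍ[ℝ]).submatrix id e)
  convert h using 1
  ext1 a b
  simp [Matrix.mul_apply, Matrix.one_apply]

/-! ### Kronecker products and separable matrices -/

theorem kronReal_add_right {m n : ℕ} (A : Matrix (Fin m) (Fin m) ℍ[ℝ])
    (B B' : Matrix (Fin n) (Fin n) ℝ) :
    kronReal A (B + B') = kronReal A B + kronReal A B' := by
  ext1 a b
  simp [kronReal, mul_add]

theorem kronReal_sum_right {m n : ℕ} {κ : Type*} (s : Finset κ) (A : Matrix (Fin m) (Fin m) ℍ[ℝ])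
    (B : κ → Matrix (Fin n) (Fin n) ℝ) :
    kronReal A (∑ k ∈ s, B k) = ∑ k ∈ s, kronReal A (B k) := by
  classical
  induction s using Finset.induction_on with
  | empty => ext1 a b; simp [kronReal]
  | insert k s hk ih => rw [Finset.sum_insert hk, Finset.sum_insert hk, kronReal_add_right, ih]

theorem IsQuatPSD.kronReal_vecMulVec {m n : ℕ} {A : Matrix (Fin m) (Fin m) ℍ[ℝ]}
    (hA : IsQuatPSD A) (x : Fin n → ℝ) : IsQuatPSD (kronReal A (Matrix.vecMulVec x x)) := by
  -- Congruence by `J = 1 ⊗ xᵀ`.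
  have h := hA.conjTranspose_mul_mul
    (Matrix.of fun (i : Fin m) (a : Fin m × Fin n) => if i = a.1 then (x a.2 : ℍ[ℝ]) else 0)
  convert h using 1
  ext1 a b
  simp only [kronReal, Matrix.kroneckerMap_apply, Matrix.map_apply, Matrix.vecMulVec_apply,
    Matrix.mul_apply, Matrix.conjTranspose_apply, Matrix.of_apply, apply_ite star, star_zero,
    Quaternion.star_coe, ite_mul, zero_mul, mul_ite, mul_zero, Finset.sum_ite_eq', Finset.mem_univ,
    if_true, Quaternion.coe_mul]
  rw [← mul_assoc, Quaternion.coe_commutes]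

theorem IsQuatPSD.kronReal {m n : ℕ} {A : Matrix (Fin m) (Fin m) ℍ[ℝ]} (hA : IsQuatPSD A)
    {B : Matrix (Fin n) (Fin n) ℝ} (hB : B.PosSemidef) : IsQuatPSD (kronReal A B) := by
  obtain ⟨w, rfl⟩ := hB.exists_eq_sum_vecMulVec
  rw [kronReal_sum_right]
  exact isQuatPSD_sum _ fun k _ => hA.kronReal_vecMulVec (w k)

theorem mem_separableMatrices_iff {m n : ℕ} {M : Matrix (Fin m × Fin n) (Fin m × Fin n) ℍ[ℝ]} :
    M ∈ separableMatrices m n ↔ ∃ (N : ℕ) (p : Fin N → ℝ) (A : Fin N → Matrix (Fin m) (Fin m) ℍ[ℝ])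
      (B : Fin N → Matrix (Fin n) (Fin n) ℝ), (∀ l, 0 < p l) ∧ (∀ l, IsQuatPSD (A l)) ∧
        (∀ l, (B l).PosSemidef) ∧ M = ∑ l, p l • kronReal (A l) (B l) := by
  constructor
  · rintro ⟨_, ⟨N, p, x, y, hp, hx, hy, rfl⟩, rfl⟩
    exact ⟨N, p, fun l => x l, fun l => y l, hp, hx, hy, by simp [map_sum]⟩
  · rintro ⟨N, p, A, B, hp, hA, hB, rfl⟩
    have hsymm : ∀ l, B l ∈ SymMat n := fun l => by
      have h := (hB l).1
      rwa [Matrix.IsHermitian, Matrix.conjTranspose_eq_transpose_of_trivial] at h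
    refine ⟨_, ⟨N, p, fun l => ⟨A l, (hA l).1⟩, fun l => ⟨B l, hsymm l⟩, hp, hA, hB, rfl⟩, ?_⟩
    simp [map_sum]

theorem sum_mem_separableMatrices {m n : ℕ} {κ : Type*} [Fintype κ] {p : ℝ} (hp : 0 < p)
    {A : κ → Matrix (Fin m) (Fin m) ℍ[ℝ]} {B : κ → Matrix (Fin n) (Fin n) ℝ}
    (hA : ∀ l, IsQuatPSD (A l)) (hB : ∀ l, (B l).PosSemidef) :
    ∑ l, p • kronReal (A l) (B l) ∈ separableMatrices m n := by
  let e := Fintype.equivFin κ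
  exact mem_separableMatrices_iff.mpr ⟨_, fun _ => p, fun l => A (e.symm l), fun l => B (e.symm l),
    fun _ => hp, fun _ => hA _, fun _ => hB _,
    (Equiv.sum_comp e.symm fun l => p • kronReal (A l) (B l)).symm⟩

theorem separableMatrices_subset_psdMatrices (m n : ℕ) :
    separableMatrices m n ⊆ psdMatrices m n := by
  intro M hM
  refine ⟨?_, ?_⟩
  · obtain ⟨w, -, rfl⟩ := hM
    exact ⟨w, rfl⟩
  · obtain ⟨N, p, A, B, hp, hA, hB, rfl⟩ := mem_separableMatrices_iff.mp hM
    exact isQuatPSD_sum _ fun l _ => ((hA l).kronReal (hB l)).smul (hp l).le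

theorem kronReal_submatrix {m n m' n' : ℕ} (A : Matrix (Fin m) (Fin m) ℍ[ℝ])
    (B : Matrix (Fin n) (Fin n) ℝ) (e : Fin m' → Fin m) (f : Fin n' → Fin n) :
    (kronReal A B).submatrix (Prod.map e f) (Prod.map e f) =
      kronReal (A.submatrix e e) (B.submatrix f f) := rfl

theorem submatrix_mem_separableMatrices {m n m' n' : ℕ}
    {M : Matrix (Fin m × Fin n) (Fin m × Fin n) ℍ[ℝ]} (hM : M ∈ separableMatrices m n)
    (e : Fin m' → Fin m) (f : Fin n' → Fin n) :
    M.submatrix (Prod.map e f) (Prod.map e f) ∈ separableMatrices m' n' := by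
  obtain ⟨N, p, A, B, hp, hA, hB, rfl⟩ := mem_separableMatrices_iff.mp hM
  refine mem_separableMatrices_iff.mpr ⟨N, p, fun l => (A l).submatrix e e,
    fun l => (B l).submatrix f f, hp, fun l => (hA l).submatrix e, fun l => (hB l).submatrix f, ?_⟩
  ext1 a b
  simp [Matrix.sum_apply, ← kronReal_submatrix]

theorem mem_quatSymSpace_iff {m n : ℕ} {M : Matrix (Fin m × Fin n) (Fin m × Fin n) ℍ[ℝ]} :
    M ∈ quatSymSpace m n ↔
      M.IsHermitian ∧ ∀ i j s t, M (i, s) (j, t) = M (i, t) (j, s) := by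
  constructor
  · rintro ⟨w, rfl⟩
    refine ⟨kron_isHermitian w, fun i j s t => ?_⟩
    induction w with
    | zero => simp
    | add x y hx hy => simp [hx, hy]
    | tmul A B =>
      have hB := B.2.apply s t
      simp [kronReal, hB]
  · rintro ⟨hM, hs⟩
    let A (s t : Fin n) : QuatHermMat m := ⟨Matrix.of fun i j => M (i, s) (j, t),
      Matrix.IsHermitian.ext fun i j => by
        rw [Matrix.of_apply, Matrix.of_apply, hM.apply]; exact hs _ _ _ _⟩
    let B (s t : Fin n) : SymMat n := ⟨Matrix.single s t (1 : ℝ) + Matrix.single t s 1, by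
      show Matrix.IsSymm _
      rw [Matrix.IsSymm, Matrix.transpose_add, Matrix.transpose_single, Matrix.transpose_single,
        add_comm]⟩
    -- The sum runs over ordered pairs, so each entry is hit twice, by `A s t` and by `A t s`, which
    -- agree by the swap symmetry.
    refine ⟨∑ s, ∑ t, (1 / 2 : ℝ) • A s t ⊗ₜ[ℝ] B s t, ?_⟩
    ext1 a b
    obtain ⟨i, s⟩ := a
    obtain ⟨j, t⟩ := b
    simp only [map_sum, map_smul, kron_tmul, Matrix.sum_apply, Matrix.smul_apply, kronReal,
      Matrix.kroneckerMap_apply, Matrix.map_apply, A, B, Matrix.of_apply, Matrix.add_apply,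
      Matrix.single_apply, Quaternion.coe_add, mul_add, smul_add, Finset.sum_add_distrib,
      apply_ite (fun x : ℝ => (x : ℍ[ℝ])), Quaternion.coe_one, Quaternion.coe_zero, mul_ite, mul_one,
      mul_zero, smul_ite, smul_zero, ite_and, Finset.sum_ite_eq', Finset.mem_univ, if_true,
      Finset.sum_ite_irrel, Finset.sum_const_zero]
    rw [hs i j t s, ← add_smul]
    norm_num

theorem submatrix_mem_psdMatrices {m n m' n' : ℕ}
    {M : Matrix (Fin m × Fin n) (Fin m × Fin n) ℍ[ℝ]} (hM : M ∈ psdMatrices m n)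
    (e : Fin m' → Fin m) (f : Fin n' → Fin n) :
    M.submatrix (Prod.map e f) (Prod.map e f) ∈ psdMatrices m' n' := by
  obtain ⟨h1, h2⟩ := hM
  refine ⟨mem_quatSymSpace_iff.mpr ⟨(h2.submatrix _).1, fun i j s t => ?_⟩, h2.submatrix _⟩
  exact (mem_quatSymSpace_iff.mp h1).2 _ _ _ _

/-! ### Separability for `n ≤ 2` or `m = 1` -/

/-- The quaternion with given coordinates. -/
def quat (a b c d : ℝ) : ℍ[ℝ] := ⟨a, b, c, d⟩

@[simp] theorem re_quat (a b c d : ℝ) : (quat a b c d).re = a := rfl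

@[simp] theorem imI_quat (a b c d : ℝ) : (quat a b c d).imI = b := rfl

@[simp] theorem imJ_quat (a b c d : ℝ) : (quat a b c d).imJ = c := rfl

@[simp] theorem imK_quat (a b c d : ℝ) : (quat a b c d).imK = d := rfl

/-- The standard real basis `1, i, j, k` of the quaternions. -/
def quatBasis : Fin 4 → ℍ[ℝ] := ![quat 1 0 0 0, quat 0 1 0 0, quat 0 0 1 0, quat 0 0 0 1]

/-- The quaternion with given coordinate vector. -/
def quatOfCoords (x : Fin 4 → ℝ) : ℍ[ℝ] := quat (x 0) (x 1) (x 2) (x 3)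

theorem re_star_quatOfCoords_mul_mul (x y : Fin 4 → ℝ) (a : ℍ[ℝ]) :
    (star (quatOfCoords x) * a * quatOfCoords y).re =
      ∑ e, x e * ∑ f, (star (quatBasis e) * a * quatBasis f).re * y f := by
  simp [quatOfCoords, quatBasis, Fin.sum_univ_four]
  ring

theorem quatOfCoords_mul_star (x y : Fin 4 → ℝ) :
    quatOfCoords x * star (quatOfCoords y) =
      ∑ e, ∑ f, (x e * y f) • (quatBasis e * star (quatBasis f)) := by
  ext <;> simp [quatOfCoords, quatBasis, Fin.sum_univ_four]

/-- For fixed `f`, the sum over `e` expands `a f` in the orthonormal basis and gives `a f f̄ = a`;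
there are four choices of `f`. -/
theorem sum_re_smul_quatBasis (a : ℍ[ℝ]) :
    ∑ e, ∑ f, (star (quatBasis e) * a * quatBasis f).re • (quatBasis e * star (quatBasis f)) =
      (4 : ℝ) • a := by
  ext <;> simp [quatBasis, Fin.sum_univ_four] <;> ring

theorem isQuatPSD_vecMulVec_star {ι : Type*} [Fintype ι] (v : ι → ℍ[ℝ]) :
    IsQuatPSD (Matrix.vecMulVec v (star v)) := by
  have h := isQuatPSD_conjTranspose_mul_self (Matrix.of fun (_ : Unit) i => star (v i))
  convert h using 1
  ext1 i j
  simp [Matrix.mul_apply, Matrix.vecMulVec_apply]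

theorem mem_separableMatrices_two {m : ℕ} {M : Matrix (Fin m × Fin 2) (Fin m × Fin 2) ℍ[ℝ]}
    (hM : M ∈ psdMatrices m 2) : M ∈ separableMatrices m 2 := by
  obtain ⟨h1, hpsd⟩ := hM
  obtain ⟨hherm, hswap⟩ := mem_quatSymSpace_iff.mp h1
  -- `T s t` is the Gram matrix of the block `M s t` in real coordinates.
  let T (s t : Fin 2) : Matrix (Fin m × Fin 4) (Fin m × Fin 4) ℝ := Matrix.of fun a b =>
    (star (quatBasis a.2) * M (a.1, s) (b.1, t) * quatBasis b.2).re
  have hT : ∀ s t, (T s t).IsSymm := fun s t => by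
    refine Matrix.IsSymm.ext fun a b => ?_
    simp only [T, Matrix.of_apply]
    rw [← Quaternion.re_star, star_mul, star_mul, star_star, hherm.apply, hswap, mul_assoc]
  have hT' : T 0 1 = T 1 0 := by
    ext a b
    simp only [T, Matrix.of_apply]
    rw [hswap]
  have hpos : ∀ x : Fin 2 → Fin m × Fin 4 → ℝ, 0 ≤ ∑ s, ∑ t, x s ⬝ᵥ (T s t *ᵥ x t) := fun x => by
    refine (hpsd.2 fun a => quatOfCoords fun e => x a.2 (a.1, e)).trans_eq ?_
    calc _ = ∑ i, ∑ s, ∑ j, ∑ t, (star (quatOfCoords fun e => x s (i, e)) * M (i, s) (j, t) *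
            quatOfCoords fun e => x t (j, e)).re := by
          simp only [dotProduct, Matrix.mulVec, Fintype.sum_prod_type, Pi.star_apply,
            Finset.mul_sum, Quaternion.re_sum, mul_assoc]
      _ = ∑ i, ∑ s, ∑ j, ∑ t, ∑ e, x s (i, e) * ∑ f, T s t (i, e) (j, f) * x t (j, f) := by
          simp only [re_star_quatOfCoords_mul_mul, T, Matrix.of_apply]
      _ = ∑ s, ∑ t, ∑ i, ∑ e, x s (i, e) * ∑ j, ∑ f, T s t (i, e) (j, f) * x t (j, f) := by
          rw [Finset.sum_comm]
          refine Finset.sum_congr rfl fun s _ => ?_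
          rw [Finset.sum_comm]
          simp only [Finset.mul_sum]
          rw [Finset.sum_comm]
          refine Eq.trans ?_ Finset.sum_comm
          refine Finset.sum_congr rfl fun i _ => ?_
          rw [Finset.sum_comm]
          refine Finset.sum_congr rfl fun t _ => ?_
          rw [Finset.sum_comm]
      _ = _ := by simp only [dotProduct, Matrix.mulVec, Fintype.sum_prod_type]
  obtain ⟨w, x, hw⟩ := exists_eq_sum_smul_vecMulVec_of_nonneg T hT hT' hpos
  have hMw : M = ∑ l, (1 / 4 : ℝ) • kronReal
      (Matrix.vecMulVec (fun i => quatOfCoords fun e => w l (i, e))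
        (star fun i => quatOfCoords fun e => w l (i, e))) (Matrix.vecMulVec (x l) (x l)) := by
    ext1 ⟨i, s⟩ ⟨j, t⟩
    have h4 : M (i, s) (j, t) = (1 / 4 : ℝ) • (4 : ℝ) • M (i, s) (j, t) := by
      rw [smul_smul]; norm_num
    have hTe : ∀ e f, (star (quatBasis e) * M (i, s) (j, t) * quatBasis f).re =
        ∑ l, x l s * x l t * (w l (i, e) * w l (j, f)) := fun e f => by
      have := congrFun (congrFun (hw s t) (i, e)) (j, f)
      simpa [T, Matrix.sum_apply, Matrix.vecMulVec_apply] using this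
    rw [h4, ← sum_re_smul_quatBasis]
    simp only [hTe, Matrix.sum_apply, Matrix.smul_apply, kronReal, Matrix.kroneckerMap_apply,
      Matrix.map_apply, Matrix.vecMulVec_apply, Pi.star_apply, quatOfCoords_mul_star,
      Quaternion.mul_coe_eq_smul, Finset.smul_sum, Finset.sum_smul, smul_smul]
    refine Eq.trans ?_ Finset.sum_comm
    exact Finset.sum_congr rfl fun e _ => Finset.sum_comm
  rw [hMw]
  refine sum_mem_separableMatrices (by norm_num) (fun l => isQuatPSD_vecMulVec_star _) fun l => ?_
  simpa using Matrix.posSemidef_vecMulVec_self_star (x l)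

theorem mem_separableMatrices_one_left {n : ℕ} {M : Matrix (Fin 1 × Fin n) (Fin 1 × Fin n) ℍ[ℝ]}
    (hM : M ∈ psdMatrices 1 n) : M ∈ separableMatrices 1 n := by
  obtain ⟨h1, hpsd⟩ := hM
  obtain ⟨hherm, hswap⟩ := mem_quatSymSpace_iff.mp h1
  -- Conjugating an entry swaps `s` and `t`, and the swap symmetry undoes this.
  have hreal : ∀ s t, M (0, s) (0, t) = ((M (0, s) (0, t)).re : ℍ[ℝ]) := fun s t => by
    rw [← Quaternion.star_eq_self, hherm.apply, hswap]
  let B : Matrix (Fin n) (Fin n) ℝ := Matrix.of fun s t => (M (0, s) (0, t)).re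
  have hMB : M = ∑ _l : Unit, (1 : ℝ) • kronReal 1 B := by
    ext1 ⟨i, s⟩ ⟨j, t⟩
    obtain rfl := Subsingleton.elim i 0
    obtain rfl := Subsingleton.elim j 0
    simpa [kronReal, B] using hreal s t
  rw [hMB]
  refine sum_mem_separableMatrices one_pos (fun _ => isQuatPSD_one) fun _ => ?_
  refine Matrix.PosSemidef.of_dotProduct_mulVec_nonneg ?_ fun x => ?_
  · refine Matrix.IsHermitian.ext fun s t => ?_
    simp only [B, Matrix.of_apply, star_trivial]
    rw [hswap]
  · refine (hpsd.2 fun a => (x a.2 : ℍ[ℝ])).trans_eq ?_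
    simp only [dotProduct, Matrix.mulVec, Fintype.sum_prod_type, Pi.star_apply, Quaternion.re_sum,
      Fin.sum_univ_one, Quaternion.star_coe, Quaternion.coe_mul_eq_smul, Quaternion.re_smul,
      Quaternion.mul_coe_eq_smul, smul_eq_mul, B, Matrix.of_apply, star_trivial, mul_comm]

theorem mem_separableMatrices_of_le_two {m n : ℕ} (hn : n ≤ 2) (hn' : 1 ≤ n)
    {M : Matrix (Fin m × Fin n) (Fin m × Fin n) ℍ[ℝ]} (hM : M ∈ psdMatrices m n) :
    M ∈ separableMatrices m n := by
  -- For `n = 1` this duplicates the only index; restricting along `Fin.castLE` recovers `M`.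
  let r : Fin 2 → Fin n := fun k => ⟨min k (n - 1), by omega⟩
  have h := submatrix_mem_separableMatrices
    (mem_separableMatrices_two (submatrix_mem_psdMatrices hM id r)) id (Fin.castLE hn)
  have hr : r ∘ Fin.castLE hn = id := by
    ext k
    simp only [r, Function.comp_apply, Fin.val_castLE, id]
    omega
  rwa [Matrix.submatrix_submatrix, Prod.map_comp_map, hr, Function.comp_id, Prod.map_id,
    Matrix.submatrix_id_id] at h

/-! ### An entangled PSD matrix for `m ≥ 2` and `n ≥ 3` -/

/-- Transposing conjugates the off-diagonal entry, and positivity of a `2 × 2` hermitian matrix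
depends only on its diagonal and the norm of that entry. -/
theorem IsQuatPSD.transpose_two {A : Matrix (Fin 2) (Fin 2) ℍ[ℝ]} (hA : IsQuatPSD A) :
    IsQuatPSD Aᵀ := by
  refine ⟨hA.1.transpose, fun u => ?_⟩
  have h0 := hA.1.apply 0 0
  have h1 := hA.1.apply 1 1
  have h2 := hA.1.apply 1 0
  have ha : (A 0 0).imI = 0 ∧ (A 0 0).imJ = 0 ∧ (A 0 0).imK = 0 := by
    simpa [Quaternion.ext_iff, eq_comm] using Quaternion.star_eq_self.mp h0
  have hb : (A 1 1).imI = 0 ∧ (A 1 1).imJ = 0 ∧ (A 1 1).imK = 0 := by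
    simpa [Quaternion.ext_iff, eq_comm] using Quaternion.star_eq_self.mp h1
  obtain ⟨ha1, ha2, ha3⟩ := ha
  obtain ⟨hb1, hb2, hb3⟩ := hb
  have key : ∀ v : Fin 2 → ℍ[ℝ], 0 ≤ (A 0 0).re * Quaternion.normSq (v 0) +
      (A 1 1).re * Quaternion.normSq (v 1) + 2 * (A 0 1 * (v 1 * star (v 0))).re := fun v => by
    refine (hA.2 v).trans_eq ?_
    simp only [dotProduct, Matrix.mulVec, Fin.sum_univ_two, ← h2, Pi.star_apply]
    simp [Quaternion.normSq_def', ha1, ha2, ha3, hb1, hb2, hb3]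
    ring
  suffices h : 0 ≤ (A 0 0).re * Quaternion.normSq (u 0) +
      (A 1 1).re * Quaternion.normSq (u 1) + 2 * (A 0 1 * (u 0 * star (u 1))).re by
    refine h.trans_eq ?_
    simp only [dotProduct, Matrix.mulVec, Fin.sum_univ_two, ← h2, Pi.star_apply,
      Matrix.transpose_apply]
    simp [Quaternion.normSq_def', ha1, ha2, ha3, hb1, hb2, hb3]
    ring
  by_cases hu : u 0 = 0
  · simpa [hu] using key ![0, u 1]
  · have hpos : 0 < Quaternion.normSq (u 0) :=
      lt_of_le_of_ne Quaternion.normSq_nonneg (Ne.symm (Quaternion.normSq_ne_zero.mpr hu))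
    -- At this vector the form of `A` is `|u 0|²` times the required expression.
    have h := key ![(Quaternion.normSq (u 0) : ℝ), u 0 * star (u 1)]
    simp only [Matrix.cons_val_zero, Matrix.cons_val_one, Quaternion.star_coe, map_mul,
      Quaternion.normSq_star, Quaternion.mul_coe_eq_smul, mul_smul_comm, Quaternion.re_smul,
      Quaternion.normSq_coe, smul_eq_mul] at h
    refine nonneg_of_mul_nonneg_right (a := Quaternion.normSq (u 0)) ?_ hpos
    linarith

theorem IsQuatPSD.transpose_of_mem_separableMatrices {n : ℕ}
    {M : Matrix (Fin 2 × Fin n) (Fin 2 × Fin n) ℍ[ℝ]} (hM : M ∈ separableMatrices 2 n) :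
    IsQuatPSD Mᵀ := by
  obtain ⟨N, p, A, B, hp, hA, hB, rfl⟩ := mem_separableMatrices_iff.mp hM
  rw [Matrix.transpose_sum]
  refine isQuatPSD_sum _ fun l _ => ?_
  rw [Matrix.transpose_smul]
  exact ((hA l).transpose_two.kronReal (hB l).transpose).smul (hp l).le

/-- A quaternionic `4 × 6` matrix `X` such that `X* X` belongs to `Q(2) ⊗ S(3)` and is not
separable. -/
noncomputable def entangledFactor : Matrix (Fin 4) (Fin 2 × Fin 3) ℍ[ℝ] := Matrix.of fun r a =>
  ![![![1, 0, 0], ![0, quat 0 0 0 1, quat 0 0 1 0]],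
    ![![0, 1, 0], ![quat 0 0 0 1, 1, quat 0 1 0 0]],
    ![![0, 0, 1], ![quat 0 0 1 0, quat 0 1 0 0, -1]],
    ![![0, 0, 0], ![0, 1, quat 0 (-3) 0 0]]] r a.1 a.2

/-- The two column blocks of the factor are `(1; 0)` and `(S; r)` with `S` symmetric. The row `r =
(0, 1, -3i)` cancels the off-diagonal entries `±3i` of `S* S`, so the product has blocks `1`, `S`,
`S*` and `diag(2, 4, 12)`, all symmetric. -/
theorem entangledFactor_mem_psdMatrices :
    entangledFactorᴴ * entangledFactor ∈ psdMatrices 2 3 := by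
  refine ⟨mem_quatSymSpace_iff.mpr ⟨Matrix.isHermitian_conjTranspose_mul_self _, ?_⟩,
    isQuatPSD_conjTranspose_mul_self _⟩
  intro i j s t
  fin_cases i <;> fin_cases j <;> fin_cases s <;> fin_cases t <;>
    simp [entangledFactor, Matrix.mul_apply, Fin.sum_univ_four, Quaternion.ext_iff] <;> norm_num

theorem entangledFactor_notMem_separableMatrices :
    entangledFactorᴴ * entangledFactor ∉ separableMatrices 2 3 := by
  intro h
  -- Transposing replaces `S` by its conjugate `S̄`. The vector is `(-S̄ y, y)` with `y = (k, 1,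
  -- 0)`, where the form is `y* diag(2, 4, 12) y - |S̄ y|² = 6 - 9 = -3`.
  obtain ⟨v, hv⟩ : ∃ v : Fin 2 × Fin 3 → ℍ[ℝ], ∀ a, v a =
      ![![quat 0 0 0 1, quat (-2) 0 0 0, quat 0 2 0 0], ![quat 0 0 0 1, 1, 0]] a.1 a.2 :=
    ⟨_, fun _ => rfl⟩
  have h' := (IsQuatPSD.transpose_of_mem_separableMatrices h).2 v
  simp [dotProduct, Matrix.mulVec, Fintype.sum_prod_type, Fin.sum_univ_succ, entangledFactor,
    Matrix.mul_apply, hv] at h'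
  norm_num at h'

theorem separableMatrices_ne_psdMatrices {m n : ℕ} (hm : 2 ≤ m) (hn : 3 ≤ n) :
    separableMatrices m n ≠ psdMatrices m n := by
  intro heq
  -- Left inverses of the inclusions: the example is pulled back to size `(m, n)` by repeating
  -- indices, then recovered by restriction.
  let r : Fin m → Fin 2 := fun k => ⟨min k 1, by omega⟩
  let r' : Fin n → Fin 3 := fun k => ⟨min k 2, by omega⟩
  have h := submatrix_mem_separableMatrices
    (heq.symm ▸ submatrix_mem_psdMatrices entangledFactor_mem_psdMatrices r r' :
      _ ∈ separableMatrices m n) (Fin.castLE hm) (Fin.castLE hn)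
  have hr : r ∘ Fin.castLE hm = id := by
    ext k
    simp only [r, Function.comp_apply, Fin.val_castLE, id]
    omega
  have hr' : r' ∘ Fin.castLE hn = id := by
    ext k
    simp only [r', Function.comp_apply, Fin.val_castLE, id]
    omega
  rw [Matrix.submatrix_submatrix, Prod.map_comp_map, hr, hr', Prod.map_id,
    Matrix.submatrix_id_id] at h
  exact entangledFactor_notMem_separableMatrices h

theorem mainTheorem6 (m n : ℕ) (hm : 1 ≤ m) (hn : 1 ≤ n) :
    separableMatrices m n = psdMatrices m n ↔ n ≤ 2 ∨ m = 1 := by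
  constructor
  · intro h
    by_contra! hne
    exact separableMatrices_ne_psdMatrices (by omega) hne.1 h
  · intro h
    refine (separableMatrices_subset_psdMatrices m n).antisymm fun M hM => ?_
    rcases h with h | rfl
    · exact mem_separableMatrices_of_le_two h hn hM
    · exact mem_separableMatrices_one_left hM
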